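/- Let $L$ be an algebraically closed field of characteristic $0$, let $n\ge 2$ and $k\ge 0$ be integers, and let $A_1,\dots,A_k\in\mathcal M_n(L)$ be arbitrary fixed $n\times n$ matrices. Let $g$ be a non-zero polynomial over $L$ in $k+1$ non-commuting indeterminates, the last of which is called $X$, such that $X$ occurs in every monomial of $g$, and let $\phi:\mathcal M_n(L)\to\mathcal M_n(L)$ be the function $\phi(X)=g(A_1,\dots,A_k,X)$, viewed as a polynomial function $L^{n^2}\to L^{n^2}$ in the entries of $X$. Let $\delta$ be the degree of $\phi$: if the image of $\phi$ is Zariski dense, then $\delta=[R:\phi^*(R)]$, where $R$ is the field of rational functions over $L$ in the $n^2$ entries of $X$ and $\phi^*:R\to R$ is the substitution $h\mapsto h\circ\phi$; if the image of $\phi$ is not Zariski dense, then $\delta=0$. Then there is a dense Zariski open set $U\subset\mathcal M_n(L)$ such that, for every $B\in U$, the equation $\phi(X)=B$ has exactly $\delta$ solutions $X\in\mathcal M_n(L)$, and all of them are simple. Here a solution $X_0$ is called simple if it is isolated (some Zariski neighbourhood of $X_0$ contains no other solution) and has multiplicity $1$, the multiplicity being the dimension over $L$ of the quotient $\mathcal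 O_{X_0}/\big((\phi_{i,j}-b_{i,j})_{i,j}\big)$ of the local ring $\mathcal O_{X_0}$ of $L^{n^2}$ at $X_0$. -/

import Mathlib

noncomputable section

namespace GenericMatrixEq

section PolynomialMaps

variable {L : Type*} [Field L] {σ : Type*}

/-- Zariski closed subsets of the affine space `L^σ`. -/
def IsZariskiClosed (Z : Set (σ → L)) : Prop :=
  ∃ I : Ideal (MvPolynomial σ L), Z = MvPolynomial.zeroLocus L I

/-- Zariski open subsets of the affine space `L^σ`. -/
def IsZariskiOpen (U : Set (σ → L)) : Prop :=
  IsZariskiClosed Uᶜ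

/-- Zariski dense subsets of the affine space `L^σ`: the only Zariski closed set containing `S`
is the whole space. -/
def IsZariskiDense (S : Set (σ → L)) : Prop :=
  ∀ Z : Set (σ → L), IsZariskiClosed Z → S ⊆ Z → Z = Set.univ

/-- A property of points of `L^σ` holds generically: it holds at all points of some dense
Zariski open set. -/
def Generically (P : (σ → L) → Prop) : Prop :=
  ∃ U : Set (σ → L), IsZariskiOpen U ∧ IsZariskiDense U ∧ ∀ u ∈ U, P u

/-- The polynomial function `L^σ → L^σ` with components `f i`. -/
def polyFun (f : σ → MvPolynomial σ L) (x : σ → L) : σ → L :=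
  fun i => MvPolynomial.eval x (f i)

/-- The function field of `L^σ` with coefficients in `L`. -/
abbrev FunctionField (L : Type*) [Field L] (σ : Type*) : Type _ :=
  FractionRing (MvPolynomial σ L)

/-- The subfield `L(f_i : i ∈ σ)` of the function field. When `f` has dense image, `f` induces a
field embedding `f^*` of the function field into itself (substitution of the `f i` for the
variables), and this subfield is the image of `f^*`. -/
def pullbackField (f : σ → MvPolynomial σ L) : IntermediateField L (FunctionField L σ) :=
  IntermediateField.adjoin L
    (Set.range fun i => algebraMap (MvPolynomial σ L) (FunctionField L σ) (f i))

open Classical in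
/-- The degree of a polynomial function `f : L^σ → L^σ`: the degree `[R : f^*(R)]` of function
fields if the image of `f` is Zariski dense, and `0` otherwise. -/
def polyMapDegree (f : σ → MvPolynomial σ L) : ℕ :=
  if IsZariskiDense (Set.range (polyFun f)) then
    Module.finrank (pullbackField f) (FunctionField L σ)
  else 0

/-- The maximal ideal of the polynomials that vanish at `x`. -/
def pointIdeal (x : σ → L) : Ideal (MvPolynomial σ L) :=
  RingHom.ker (MvPolynomial.eval x)

instance pointIdeal_isPrime (x : σ → L) : (pointIdeal x).IsPrime :=
  RingHom.ker_isPrime (MvPolynomial.eval x)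

/-- The local ring of `L^σ` at the point `x`. -/
abbrev LocalRingAt (x : σ → L) : Type _ :=
  Localization.AtPrime (pointIdeal x)

/-- The ideal of the local ring at `x` generated by the polynomials `s i`. -/
def localIdeal (s : σ → MvPolynomial σ L) (x : σ → L) : Ideal (LocalRingAt x) :=
  Ideal.span (Set.range fun i => algebraMap (MvPolynomial σ L) (LocalRingAt x) (s i))

/-- The multiplicity at `x` of the polynomial system `s i = 0`, `i ∈ σ`: the dimension over `L` of
the local ring at `x` modulo the ideal generated by the `s i`. -/
def multiplicity (s : σ → MvPolynomial σ L) (x : σ → L) : ℕ :=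
  Module.finrank L (LocalRingAt x ⧸ localIdeal s x)

/-- `x` is an isolated solution of the system `s i = 0`, `i ∈ σ`. -/
def IsIsolatedSolution (s : σ → MvPolynomial σ L) (x : σ → L) : Prop :=
  polyFun s x = 0 ∧
    ∃ U : Set (σ → L), IsZariskiOpen U ∧ x ∈ U ∧ ∀ y ∈ U, polyFun s y = 0 → y = x

/-- `x` is a simple solution of the system `s i = 0`, `i ∈ σ`: it is isolated, of
multiplicity `1`. -/
def IsSimpleSolution (s : σ → MvPolynomial σ L) (x : σ → L) : Prop :=
  IsIsolatedSolution s x ∧ multiplicity s x = 1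

end PolynomialMaps

section Matrices

variable {L : Type*} [Field L] {k n : ℕ}

/-- Polynomials over `L` in `k + 1` non-commuting indeterminates: `some r` is the index of the
indeterminate for the `r`-th coefficient matrix, `none` that of the unknown `X`. -/
abbrev NCPoly (L : Type*) [Field L] (k : ℕ) : Type _ :=
  FreeAlgebra L (Option (Fin k))

/-- Every monomial (word with non-zero coefficient) of `g` contains the indeterminate `X`. -/
def EveryMonomialContainsX (g : NCPoly L k) : Prop :=
  ∀ w ∈ (FreeAlgebra.equivMonoidAlgebraFreeMonoid (R := L) g).coeff.support,
    none ∈ FreeMonoid.toList w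

/-- The matrix function `φ(X) = g(A_1, …, A_k, X)`. -/
def phi (g : NCPoly L k) (A : Fin k → Matrix (Fin n) (Fin n) L)
    (X : Matrix (Fin n) (Fin n) L) : Matrix (Fin n) (Fin n) L :=
  FreeAlgebra.lift L (fun o : Option (Fin k) => o.elim X A) g

/-- A matrix as a point of the affine space of its entries. -/
def entries (M : Matrix (Fin n) (Fin n) L) : Fin n × Fin n → L :=
  fun p => M p.1 p.2

/-- The entries of `φ(X)` as polynomials in the entries of `X`. -/
def phiPoly (g : NCPoly L k) (A : Fin k → Matrix (Fin n) (Fin n) L) :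
    Fin n × Fin n → MvPolynomial (Fin n × Fin n) L :=
  fun p => FreeAlgebra.lift L
    (fun o : Option (Fin k) =>
      o.elim (Matrix.mvPolynomialX (Fin n) (Fin n) L)
        (fun r => (A r).map (MvPolynomial.C (σ := Fin n × Fin n)))) g p.1 p.2

/-- The polynomials `phiPoly g A` do define the function `phi g A`. -/
theorem polyFun_phiPoly (g : NCPoly L k) (A : Fin k → Matrix (Fin n) (Fin n) L)
    (X : Matrix (Fin n) (Fin n) L) :
    polyFun (phiPoly g A) (entries X) = entries (phi g A X) := by
  have h : ((MvPolynomial.aeval (R := L) (entries X)).mapMatrix.comp (FreeAlgebra.lift L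
      (fun o : Option (Fin k) =>
        o.elim (Matrix.mvPolynomialX (Fin n) (Fin n) L)
          (fun r => (A r).map (MvPolynomial.C (σ := Fin n × Fin n)))))) =
      FreeAlgebra.lift L (fun o : Option (Fin k) => o.elim X A) := by
    apply FreeAlgebra.hom_ext
    funext o
    cases o <;> ext i j <;> simp [entries]
  funext p
  have h2 := congrFun (congrFun (DFunLike.congr_fun h g) p.1) p.2
  simpa [polyFun, phiPoly, phi, entries, MvPolynomial.aeval_eq_eval] using h2

/-- The degree of the polynomial function `φ : M_n(L) → M_n(L)`. -/
def phiDegree (g : NCPoly L k) (A : Fin k → Matrix (Fin n) (Fin n) L) : ℕ :=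
  polyMapDegree (phiPoly g A)

/-- The polynomial system, in the entries of `X`, of the equation `φ(X) = B`. -/
def eqSystem (g : NCPoly L k) (A : Fin k → Matrix (Fin n) (Fin n) L)
    (B : Matrix (Fin n) (Fin n) L) : Fin n × Fin n → MvPolynomial (Fin n × Fin n) L :=
  fun p => phiPoly g A p - MvPolynomial.C (B p.1 p.2)

end Matrices

end GenericMatrixEq

end

open Polynomial in
/-- A primitive element for a finite separable extension of fraction fields, chosen in the upper
ring, together with its minimal polynomial with denominators cleared. -/
theorem exists_integral_primitive_element_aux {R S K F : Type*} [CommRing R] [IsDomain R]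
    [CommRing S] [IsDomain S] [Field K] [Field F] [Algebra R S] [Algebra R K] [Algebra R F]
    [Algebra S F] [Algebra K F] [IsScalarTower R S F] [IsScalarTower R K F] [IsFractionRing R K]
    [IsFractionRing S F] [FiniteDimensional K F] [Algebra.IsSeparable K F] :
    ∃ (θ : S) (m U V : R[X]) (e : R), m.natDegree = Module.finrank K F ∧ e ≠ 0 ∧
      aeval θ m = 0 ∧ U * m + V * derivative m = C e ∧
      (∀ Q : R[X], aeval θ Q = 0 → ∃ s : R, s ≠ 0 ∧ m ∣ C s * Q) ∧
      ∀ x : S, ∃ d : R, d ≠ 0 ∧ ∃ P : R[X], algebraMap R S d * x = aeval θ P := by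
  have hSF : Function.Injective (algebraMap S F) := IsFractionRing.injective S F
  have hRK : Function.Injective (algebraMap R K) := IsFractionRing.injective R K
  have hRF : Function.Injective (algebraMap R F) := by
    rw [IsScalarTower.algebraMap_eq R K F]
    exact (algebraMap K F).injective.comp hRK
  have hmap : Function.Injective (map (algebraMap R K)) := map_injective _ hRK
  have halg : Algebra.IsAlgebraic R F :=
    (IsFractionRing.comap_isAlgebraic_iff (A := R) (K := K) (C := F)).2 inferInstance
  have hnorm : ∀ p : K[X], ∃ (b : R) (P : R[X]), b ≠ 0 ∧
      P.map (algebraMap R K) = C (algebraMap R K b) * p := fun p => by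
    obtain ⟨b, hb0, hb⟩ := IsLocalization.integerNormalization_spec (nonZeroDivisors R) p
    refine ⟨b, _, nonZeroDivisors.ne_zero hb0, hb.trans ?_⟩
    rw [← smul_eq_C_mul, algebraMap_smul]
  have hev : ∀ (θ : S) (P : R[X]),
      algebraMap S F (aeval θ P) = aeval (algebraMap S F θ) (P.map (algebraMap R K)) :=
    fun θ P => by rw [aeval_map_algebraMap, aeval_algebraMap_apply]
  obtain ⟨α, hα⟩ := Field.exists_primitive_element K F
  obtain ⟨θ, d₀, hd₀, hθ⟩ : ∃ (θ : S) (d₀ : R), d₀ ≠ 0 ∧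
      algebraMap S F θ = algebraMap K F (algebraMap R K d₀) * α := by
    obtain ⟨u, v, hv, huv⟩ := IsFractionRing.div_surjective (A := S) α
    have : Algebra.IsAlgebraic R S :=
      ⟨fun x => (isAlgebraic_algebraMap_iff hSF).1 (halg.isAlgebraic _)⟩
    obtain ⟨c, d, hd, hdc⟩ := Algebra.IsAlgebraic.exists_smul_eq_mul R u (nonZeroDivisors.ne_zero hv)
    refine ⟨c, d, hd, ?_⟩
    have hv0 : algebraMap S F v ≠ 0 :=
      (map_ne_zero_iff _ hSF).2 (nonZeroDivisors.ne_zero hv)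
    rw [← IsScalarTower.algebraMap_apply, ← huv, ← mul_div_assoc, eq_div_iff hv0, ← map_mul,
      mul_comm, ← hdc, Algebra.smul_def, map_mul, ← IsScalarTower.algebraMap_apply]
  have hd₀K : algebraMap R K d₀ ≠ 0 := (map_ne_zero_iff _ hRK).2 hd₀
  have hθtop : IntermediateField.adjoin K {algebraMap S F θ} = ⊤ := by
    rw [eq_top_iff, ← hα, IntermediateField.adjoin_simple_le_iff]
    have h1 : α = algebraMap K F (algebraMap R K d₀)⁻¹ * algebraMap S F θ := by
      rw [hθ, ← mul_assoc, ← map_mul, inv_mul_cancel₀ hd₀K, map_one, one_mul]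
    rw [h1]
    exact mul_mem (IntermediateField.algebraMap_mem _ _)
      (IntermediateField.mem_adjoin_simple_self K _)
  have hint : IsIntegral K (algebraMap S F θ) := IsIntegral.of_finite K _
  set μ := minpoly K (algebraMap S F θ) with hμ
  obtain ⟨b, m, hb, hm⟩ := hnorm μ
  have hbK : algebraMap R K b ≠ 0 := (map_ne_zero_iff _ hRK).2 hb
  have hsep : μ.Separable := Algebra.IsSeparable.isSeparable K (algebraMap S F θ)
  have hmsep : (m.map (algebraMap R K)).Separable := by
    rw [hm]
    exact hsep.unit_mul (isUnit_C.2 hbK.isUnit)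
  obtain ⟨u, v, huv⟩ := hmsep
  obtain ⟨b₁, U, hb₁, hU⟩ := hnorm u
  obtain ⟨b₂, V, hb₂, hV⟩ := hnorm v
  refine ⟨θ, m, C b₂ * U, C b₁ * V, b₂ * b₁, ?_, mul_ne_zero hb₂ hb₁, ?_, ?_, ?_, ?_⟩
  · rw [← natDegree_map_eq_of_injective hRK, hm, natDegree_C_mul hbK,
      ← IntermediateField.adjoin.finrank hint, hθtop, IntermediateField.finrank_top']
  · apply hSF
    rw [hev, hm, map_mul, minpoly.aeval, mul_zero, map_zero]
  · apply hmap
    simp only [Polynomial.map_add, Polynomial.map_mul, map_C, ← derivative_map, hU, hV, map_mul]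
    linear_combination (C (algebraMap R K b₂) * C (algebraMap R K b₁)) * huv
  · intro Q hQ
    have h1 : μ ∣ Q.map (algebraMap R K) := minpoly.dvd _ _ (by rw [← hev, hQ, map_zero])
    obtain ⟨q, hq⟩ := h1
    obtain ⟨c, q', hc, hq'⟩ := hnorm q
    refine ⟨b * c, mul_ne_zero hb hc, q', hmap ?_⟩
    simp only [Polynomial.map_mul, map_C, hq, hm, hq', map_mul]
    ring
  · intro x
    have h1 : algebraMap S F x ∈ IntermediateField.adjoin K {algebraMap S F θ} := by
      rw [hθtop]; trivial
    rw [← IntermediateField.mem_toSubalgebra,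
      IntermediateField.adjoin_simple_toSubalgebra_of_isAlgebraic hint.isAlgebraic,
      Algebra.adjoin_singleton_eq_range_aeval] at h1
    obtain ⟨p, hp⟩ := h1
    obtain ⟨c, P, hc, hP⟩ := hnorm p
    refine ⟨c, hc, P, hSF ?_⟩
    rw [hev, hP, map_mul, map_mul, aeval_C, ← IsScalarTower.algebraMap_apply,
      ← IsScalarTower.algebraMap_apply]
    exact congrArg _ hp.symm

open Polynomial in
/-- A version of `exists_integral_primitive_element_aux` phrased with ring homomorphisms, so that
the two rings may coincide. -/
theorem exists_integral_primitive_element {R S K F : Type*} [CommRing R] [IsDomain R]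
    [CommRing S] [IsDomain S] [Field K] [Field F] [Algebra S F] [Algebra K F] [IsFractionRing S F]
    [FiniteDimensional K F] [Algebra.IsSeparable K F] (φ : R →+* S) (κ : R →+* K)
    (hφ : Function.Injective φ) (hκφ : ∀ r, algebraMap K F (κ r) = algebraMap S F (φ r))
    (hκ : ∀ z : K, ∃ r s, z = κ r / κ s) :
    ∃ (θ : S) (m U V : R[X]) (e : R), m.natDegree = Module.finrank K F ∧ e ≠ 0 ∧
      eval₂ φ θ m = 0 ∧ U * m + V * derivative m = C e ∧
      (∀ Q : R[X], eval₂ φ θ Q = 0 → ∃ s : R, s ≠ 0 ∧ m ∣ C s * Q) ∧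
      ∀ x : S, ∃ d : R, d ≠ 0 ∧ ∃ P : R[X], φ d * x = eval₂ φ θ P := by
  let := φ.toAlgebra
  let := κ.toAlgebra
  let := ((algebraMap S F).comp φ).toAlgebra
  have : IsScalarTower R S F := IsScalarTower.of_algebraMap_eq fun _ => rfl
  have : IsScalarTower R K F := IsScalarTower.of_algebraMap_eq fun r => (hκφ r).symm
  have hκinj : Function.Injective κ := fun x y h => hφ <| IsFractionRing.injective S F <| by
    rw [← hκφ, ← hκφ, h]
  have : FaithfulSMul R K := (faithfulSMul_iff_algebraMap_injective R K).2 hκinj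
  have : IsFractionRing R K := IsFractionRing.of_field R K fun z => by
    obtain ⟨r, s, h⟩ := hκ z
    exact ⟨r, s, h⟩
  exact exists_integral_primitive_element_aux (R := R) (S := S) (K := K) (F := F)

namespace GenericMatrixEq

open MvPolynomial

section Density

variable {L : Type*} [Field L] {σ : Type*}

theorem isZariskiOpen_ne_zero (p : MvPolynomial σ L) :
    IsZariskiOpen {x : σ → L | eval x p ≠ 0} := by
  refine ⟨Ideal.span {p}, ?_⟩
  ext x
  simp [zeroLocus_span, aeval_eq_eval]

theorem isZariskiDense_ne_zero [Infinite L] {p : MvPolynomial σ L} (hp : p ≠ 0) :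
    IsZariskiDense {x : σ → L | eval x p ≠ 0} := by
  rintro Z ⟨I, rfl⟩ hZ
  refine Set.eq_univ_of_forall fun x q hq => ?_
  have h : p * q = 0 := MvPolynomial.funext fun y => by
    by_cases hy : eval y p = 0
    · simp [hy]
    · have := hZ (show y ∈ {x : σ → L | eval x p ≠ 0} from hy) q hq
      rw [aeval_eq_eval] at this
      simp [this]
  rw [(mul_eq_zero.1 h).resolve_left hp, map_zero]

theorem generically_of_ne_zero [Infinite L] {p : MvPolynomial σ L} (hp : p ≠ 0)
    {P : (σ → L) → Prop} (h : ∀ x, eval x p ≠ 0 → P x) : Generically P :=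
  ⟨_, isZariskiOpen_ne_zero p, isZariskiDense_ne_zero hp, h⟩

theorem exists_ne_zero_of_not_isZariskiDense {S : Set (σ → L)} (h : ¬ IsZariskiDense S) :
    ∃ p : MvPolynomial σ L, p ≠ 0 ∧ ∀ x ∈ S, eval x p = 0 := by
  simp only [IsZariskiDense, not_forall] at h
  obtain ⟨_, ⟨I, rfl⟩, hS, hI⟩ := h
  have : I ≠ ⊥ := by
    rintro rfl
    exact hI zeroLocus_bot
  obtain ⟨p, hpI, hp⟩ := Submodule.exists_mem_ne_zero_of_ne_bot this
  exact ⟨p, hp, fun x hx => by simpa [aeval_eq_eval] using hS hx p hpI⟩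

theorem eval_aeval (f : σ → MvPolynomial σ L) (x : σ → L) (p : MvPolynomial σ L) :
    eval x (aeval f p) = eval (polyFun f x) p := by
  induction p using MvPolynomial.induction_on with
  | C a => simp
  | add p q hp hq => rw [map_add, map_add, map_add, hp, hq]
  | mul_X p i hp => rw [map_mul, map_mul, map_mul, hp, aeval_X, eval_X, polyFun]

theorem algebraicIndependent_of_isZariskiDense [Infinite L] {f : σ → MvPolynomial σ L}
    (hf : IsZariskiDense (Set.range (polyFun f))) : AlgebraicIndependent L f := by
  rw [AlgebraicIndependent, injective_iff_map_eq_zero]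
  intro p hp
  have h := hf (zeroLocus L (Ideal.span {p})) ⟨_, rfl⟩ (by
    rintro _ ⟨x, rfl⟩
    simp only [zeroLocus_span, Set.mem_singleton_iff, forall_eq, Set.mem_ofPred_eq, aeval_eq_eval]
    change eval _ p = 0
    rw [← eval_aeval, hp, map_zero])
  refine MvPolynomial.funext fun x => ?_
  have hx : x ∈ zeroLocus L (Ideal.span {p}) := h ▸ Set.mem_univ x
  simpa [zeroLocus_span, aeval_eq_eval] using hx

end Density

section FieldExtension

variable {L : Type*} [Field L] {σ : Type*}

theorem trdeg_functionField :
    Algebra.trdeg L (FunctionField L σ) = Algebra.trdeg L (MvPolynomial σ L) := by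
  have : Algebra.IsAlgebraic (MvPolynomial σ L) (FunctionField L σ) :=
    IsLocalization.isAlgebraic _ (nonZeroDivisors (MvPolynomial σ L))
  have h := trdeg_add_eq L (MvPolynomial σ L) (A := FunctionField L σ)
  have h0 : Algebra.trdeg (MvPolynomial σ L) (FunctionField L σ) = 0 := trdeg_eq_zero
  rw [← h, h0, add_zero]

theorem finiteDimensional_pullbackField [Finite σ] {f : σ → MvPolynomial σ L}
    (hf : AlgebraicIndependent L f) :
    FiniteDimensional (pullbackField f) (FunctionField L σ) := by
  have h1 : AlgebraicIndependent L
      (fun i => algebraMap (MvPolynomial σ L) (FunctionField L σ) (f i)) :=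
    hf.map' (f := IsScalarTower.toAlgHom L (MvPolynomial σ L) (FunctionField L σ))
      (IsFractionRing.injective _ _)
  have h2 := h1.isTranscendenceBasis_of_lift_trdeg_le_of_finite (by
    rw [trdeg_functionField, MvPolynomial.trdeg_of_isDomain]
    simp)
  have : Algebra.IsAlgebraic (pullbackField f) (FunctionField L σ) := h2.isAlgebraic_field
  have : Algebra.EssFiniteType (MvPolynomial σ L) (FunctionField L σ) :=
    Algebra.EssFiniteType.of_isLocalization _ (nonZeroDivisors (MvPolynomial σ L))
  have : Algebra.EssFiniteType L (FunctionField L σ) :=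
    Algebra.EssFiniteType.comp L (MvPolynomial σ L) (FunctionField L σ)
  have : Algebra.EssFiniteType (pullbackField f) (FunctionField L σ) :=
    Algebra.EssFiniteType.of_comp L _ _
  exact Algebra.finite_of_essFiniteType_of_isAlgebraic

/-- Substitution of the `f i`, with values in the subfield `L(f_i : i ∈ σ)`. -/
noncomputable def toPullbackField (f : σ → MvPolynomial σ L) : MvPolynomial σ L →ₐ[L] pullbackField f :=
  aeval fun i => ⟨_, IntermediateField.subset_adjoin L _ ⟨i, rfl⟩⟩

theorem algebraMap_toPullbackField (f : σ → MvPolynomial σ L) (r : MvPolynomial σ L) :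
    algebraMap (pullbackField f) (FunctionField L σ) (toPullbackField f r) =
      algebraMap (MvPolynomial σ L) (FunctionField L σ) (aeval f r) := by
  have h : (pullbackField f).val.comp (toPullbackField f) =
      (IsScalarTower.toAlgHom L (MvPolynomial σ L) (FunctionField L σ)).comp (aeval f) := by
    apply MvPolynomial.algHom_ext
    intro i
    simp [toPullbackField]
  exact DFunLike.congr_fun h r

theorem exists_eq_toPullbackField_div (f : σ → MvPolynomial σ L) (z : pullbackField f) :
    ∃ r s, z = toPullbackField f r / toPullbackField f s := by
  obtain ⟨r, s, h⟩ := (IntermediateField.mem_adjoin_range_iff L _ _).1 z.2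
  refine ⟨r, s, (algebraMap (pullbackField f) (FunctionField L σ)).injective ?_⟩
  rw [map_div₀, algebraMap_toPullbackField, algebraMap_toPullbackField]
  refine h.trans ?_
  congr 1 <;>
  · rw [← IsScalarTower.toAlgHom_apply L (MvPolynomial σ L), ← AlgHom.comp_apply, comp_aeval]
    rfl

end FieldExtension

section Multiplicity

variable {L : Type*} [Field L] {σ : Type*}

theorem localIdeal_ne_top {s : σ → MvPolynomial σ L} {x : σ → L} (hs : polyFun s x = 0) :
    localIdeal s x ≠ ⊤ := by
  refine ne_top_of_le_ne_top (Ideal.IsMaximal.ne_top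
    (inferInstance : (IsLocalRing.maximalIdeal (LocalRingAt x)).IsMaximal)) ?_
  rw [localIdeal, Ideal.span_le]
  rintro _ ⟨i, rfl⟩
  exact (IsLocalization.AtPrime.to_map_mem_maximal_iff _ (pointIdeal x) _).2 (congrFun hs i)

/-- The canonical map from the polynomial ring to the quotient of the local ring at `x` that
defines the multiplicity. -/
noncomputable def toLocalQuotient (s : σ → MvPolynomial σ L) (x : σ → L) :
    MvPolynomial σ L →ₐ[L] LocalRingAt x ⧸ localIdeal s x :=
  (Ideal.Quotient.mkₐ L (localIdeal s x)).comp
    (IsScalarTower.toAlgHom L (MvPolynomial σ L) (LocalRingAt x))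

theorem toLocalQuotient_apply_self (s : σ → MvPolynomial σ L) (x : σ → L) (i : σ) :
    toLocalQuotient s x (s i) = 0 :=
  Ideal.Quotient.eq_zero_iff_mem.2 (Ideal.subset_span ⟨i, rfl⟩)

theorem isUnit_toLocalQuotient (s : σ → MvPolynomial σ L) {x : σ → L} {q : MvPolynomial σ L}
    (hq : eval x q ≠ 0) : IsUnit (toLocalQuotient s x q) :=
  ((IsLocalization.AtPrime.isUnit_to_map_iff (LocalRingAt x) (pointIdeal x) q).2 hq).map
    (Ideal.Quotient.mkₐ L (localIdeal s x))

/-- If the coordinate functions are constant in the quotient of the local ring, then the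
multiplicity is `1`. -/
theorem multiplicity_eq_one {s : σ → MvPolynomial σ L} {x : σ → L} (hs : polyFun s x = 0)
    (h : ∀ i, toLocalQuotient s x (X i) = algebraMap L _ (x i)) : multiplicity s x = 1 := by
  have : Nontrivial (LocalRingAt x ⧸ localIdeal s x) :=
    Ideal.Quotient.nontrivial_iff.2 (localIdeal_ne_top hs)
  have key : ∀ p, toLocalQuotient s x p = algebraMap L _ (eval x p) := by
    have : toLocalQuotient s x = (Algebra.ofId L _).comp (aeval x) := by
      apply MvPolynomial.algHom_ext
      intro i
      rw [h, AlgHom.comp_apply, aeval_X]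
      rfl
    intro p
    rw [this, AlgHom.comp_apply, aeval_eq_eval]
    rfl
  refine finrank_eq_one 1 one_ne_zero fun w => ?_
  obtain ⟨z, rfl⟩ := Ideal.Quotient.mk_surjective w
  obtain ⟨p, q, hz⟩ := IsLocalization.exists_mk'_eq (pointIdeal x).primeCompl z
  have hq : eval x (q : MvPolynomial σ L) ≠ 0 := q.2
  refine ⟨eval x p / eval x (q : MvPolynomial σ L), ?_⟩
  have h1 : Ideal.Quotient.mk (localIdeal s x) z * toLocalQuotient s x q =
      toLocalQuotient s x p := by
    rw [← hz]
    exact (map_mul (Ideal.Quotient.mk (localIdeal s x)) _ _).symm.trans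
      (congrArg _ (IsLocalization.mk'_spec _ _ _))
  rw [key, key] at h1
  refine (Algebra.algebraMap_eq_smul_one (A := LocalRingAt x ⧸ localIdeal s x) _).symm.trans ?_
  rw [div_eq_mul_inv, map_mul, ← h1, mul_assoc, ← map_mul, mul_inv_cancel₀ hq, map_one, mul_one]

end Multiplicity

section Denominators

universe u

variable {L : Type u} [Field L] {σ : Type}

/-- Clearing the denominator `d` in the expression `q (P i / d : i ∈ σ)`. -/
theorem exists_pow_mul_aeval_eq {A : Type*} [CommRing A] [Algebra L A] (d : A) (P : σ → A)
    (q : MvPolynomial σ L) :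
    ∃ (N : ℕ) (Q : A), ∀ {B : Type u} [CommRing B] [Algebra L B] (h : A →ₐ[L] B) (x : σ → B),
      (∀ i, h d * x i = h (P i)) → h d ^ N * aeval x q = h Q := by
  induction q using MvPolynomial.induction_on with
  | C a => exact ⟨0, algebraMap L A a, fun h x _ => by simp⟩
  | add p q hp hq =>
    obtain ⟨N, Q, hp⟩ := hp
    obtain ⟨M, R, hq⟩ := hq
    refine ⟨N + M, d ^ M * Q + d ^ N * R, fun h x hx => ?_⟩
    simp only [map_add, map_mul, map_pow, ← hp h x hx, ← hq h x hx]
    ring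
  | mul_X p i hp =>
    obtain ⟨N, Q, hp⟩ := hp
    refine ⟨N + 1, Q * P i, fun h x hx => ?_⟩
    simp only [map_mul, aeval_X, ← hp h x hx, ← hx i]
    ring

/-- Polynomials in one variable over a polynomial ring are evaluated by prescribing values for the
coefficients and for the variable. -/
noncomputable def substHom {B : Type*} [CommRing B] [Algebra L B]
    (ψ : MvPolynomial σ L →ₐ[L] B) (t : B) : Polynomial (MvPolynomial σ L) →ₐ[L] B :=
  Polynomial.eval₂AlgHom ψ t fun _ => Commute.all _ _

@[simp]
theorem substHom_C {B : Type*} [CommRing B] [Algebra L B] (ψ : MvPolynomial σ L →ₐ[L] B) (t : B)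
    (r : MvPolynomial σ L) : substHom ψ t (Polynomial.C r) = ψ r :=
  Polynomial.eval₂_C _ _

@[simp]
theorem substHom_X {B : Type*} [CommRing B] [Algebra L B] (ψ : MvPolynomial σ L →ₐ[L] B) (t : B) :
    substHom ψ t Polynomial.X = t :=
  Polynomial.eval₂_X _ _

theorem substHom_aeval (b : σ → L) (t : L) (P : Polynomial (MvPolynomial σ L)) :
    substHom (aeval b) t P = (P.map (eval b)).eval t := by
  rw [Polynomial.eval_map]
  rfl

theorem map_substHom {B : Type*} [CommRing B] [Algebra L B] {f : σ → MvPolynomial σ L}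
    {ψ : MvPolynomial σ L →ₐ[L] B} {b : σ → L} (hψ : ∀ i, ψ (f i) = algebraMap L B (b i))
    (θ : MvPolynomial σ L) (P : Polynomial (MvPolynomial σ L)) :
    ψ (substHom (aeval f) θ P) = Polynomial.aeval (ψ θ) (P.map (eval b)) := by
  have h : (ψ : MvPolynomial σ L →+* B).comp (aeval f : MvPolynomial σ L →ₐ[L] MvPolynomial σ L) =
      (algebraMap L B).comp (eval b) := by
    apply MvPolynomial.ringHom_ext
    · intro r
      simp [← MvPolynomial.algebraMap_eq]
    · intro i
      simp [hψ]
  rw [Polynomial.aeval_def, Polynomial.eval₂_map, ← h]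
  exact Polynomial.hom_eval₂ P _ (ψ : MvPolynomial σ L →+* B) θ

/-- A polynomial identity in the function field specializes to points over a generic base point. -/
theorem exists_specialization {f : σ → MvPolynomial σ L} {θ d : MvPolynomial σ L}
    {m : Polynomial (MvPolynomial σ L)} {P : σ → Polynomial (MvPolynomial σ L)}
    (hm : ∀ Q, substHom (aeval f) θ Q = 0 → ∃ s, s ≠ 0 ∧ m ∣ Polynomial.C s * Q)
    (hP : ∀ i, aeval f d * X i = substHom (aeval f) θ (P i))
    (W : Polynomial (MvPolynomial σ L)) :
    ∃ s : MvPolynomial σ L, s ≠ 0 ∧ ∀ (b : σ → L) (t : L) (x : σ → L), eval b s ≠ 0 →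
      eval b d ≠ 0 → (m.map (eval b)).eval t = 0 →
      (∀ i, eval b d * x i = ((P i).map (eval b)).eval t) →
      eval x (substHom (aeval f) θ W) = (W.map (eval b)).eval t := by
  obtain ⟨N, Q, hQ⟩ := exists_pow_mul_aeval_eq (Polynomial.C d) P (substHom (aeval f) θ W)
  have h1 := hQ (substHom (aeval f) θ) X (by simpa using hP)
  rw [aeval_X_left_apply] at h1
  obtain ⟨s, hs, R, hR⟩ := hm (Q - Polynomial.C d ^ N * W) (by
    rw [map_sub, map_mul, map_pow, ← h1, sub_self])
  refine ⟨s, hs, fun b t x hbs hbd hmt hx => ?_⟩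
  have h2 := hQ (substHom (aeval b) t) x (by
    simpa [substHom_aeval, aeval_eq_eval] using hx)
  have h3 := congrArg (substHom (aeval b) t) hR
  rw [map_mul, map_mul, map_sub, map_mul, map_pow, ← h2, substHom_aeval b t m, hmt, zero_mul,
    ← mul_sub, substHom_C, substHom_C, aeval_eq_eval, aeval_eq_eval] at h3
  have h4 := (mul_eq_zero.1 ((mul_eq_zero.1 h3).resolve_left hbs)).resolve_left
    (pow_ne_zero _ hbd)
  rw [← substHom_aeval]
  exact sub_eq_zero.1 h4

end Denominators

section GenericFibre

universe u

variable {L : Type u} [Field L] {σ : Type}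

/-- Over a generic base point, the fibre of a dominant polynomial map is parametrized by the roots
of the specialized minimal polynomial of a primitive element. -/
theorem exists_fibre_parametrization [CharZero L] [Finite σ] {f : σ → MvPolynomial σ L}
    (hf : IsZariskiDense (Set.range (polyFun f))) :
    ∃ (θ d D : MvPolynomial σ L) (m : Polynomial (MvPolynomial σ L))
      (P : σ → Polynomial (MvPolynomial σ L)), D ≠ 0 ∧ substHom (aeval f) θ m = 0 ∧
      (∀ i, aeval f d * X i = substHom (aeval f) θ (P i)) ∧
      ∀ b, eval b D ≠ 0 → eval b d ≠ 0 ∧ (m.map (eval b)).Separable ∧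
        (m.map (eval b)).natDegree = polyMapDegree f ∧
        ∀ t, (m.map (eval b)).eval t = 0 → ∃ x, polyFun f x = b ∧ eval x θ = t := by
  classical
  cases nonempty_fintype σ
  have hind := algebraicIndependent_of_isZariskiDense hf
  have := finiteDimensional_pullbackField hind
  obtain ⟨θ, m, U, V, e, hdeg, he, hθm, hUV, hm, hden⟩ := exists_integral_primitive_element
    (F := FunctionField L σ) (aeval f : MvPolynomial σ L →ₐ[L] MvPolynomial σ L).toRingHom
    (toPullbackField f).toRingHom hind (algebraMap_toPullbackField f)
    (exists_eq_toPullbackField_div f)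
  replace hm : ∀ Q, substHom (aeval f) θ Q = 0 → ∃ s, s ≠ 0 ∧ m ∣ Polynomial.C s * Q := hm
  have hm0 : m ≠ 0 := by
    rintro rfl
    rw [Polynomial.natDegree_zero] at hdeg
    exact Module.finrank_pos.ne hdeg
  choose d hd P hP using fun i : σ => hden (X i)
  set P' : σ → Polynomial (MvPolynomial σ L) :=
    fun i => Polynomial.C (∏ j ∈ Finset.univ.erase i, d j) * P i
  have hP' : ∀ i, aeval f (∏ j, d j) * X i = substHom (aeval f) θ (P' i) := fun i => by
    have h : aeval f (d i) * X i = substHom (aeval f) θ (P i) := hP i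
    rw [← Finset.prod_erase_mul _ _ (Finset.mem_univ i), map_mul, mul_assoc, h, map_mul,
      substHom_C]
  choose s hs hspec using exists_specialization hm hP'
  refine ⟨θ, ∏ j, d j, (∏ j, d j) * (m.leadingCoeff * (e * (s Polynomial.X *
    ∏ j, s (Polynomial.C (X j))))), m, P', ?_, hθm, hP', fun b hb => ?_⟩
  · exact mul_ne_zero (Finset.prod_ne_zero_iff.2 fun j _ => hd j) <|
      mul_ne_zero (Polynomial.leadingCoeff_ne_zero.2 hm0) <| mul_ne_zero he <|
      mul_ne_zero (hs _) (Finset.prod_ne_zero_iff.2 fun j _ => hs _)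
  · simp only [map_mul, mul_ne_zero_iff] at hb
    obtain ⟨hbd, hbm, hbe, hbs, hbss⟩ := hb
    rw [map_prod, Finset.prod_ne_zero_iff] at hbss
    refine ⟨hbd, ?_, ?_, fun t ht => ?_⟩
    · have h := congrArg (Polynomial.map (eval b)) hUV
      simp only [Polynomial.map_add, Polynomial.map_mul, Polynomial.map_C,
        ← Polynomial.derivative_map] at h
      refine ⟨Polynomial.C (eval b e)⁻¹ * U.map (eval b), Polynomial.C (eval b e)⁻¹ *
        V.map (eval b), ?_⟩
      rw [mul_assoc, mul_assoc, ← mul_add, h, ← Polynomial.C_mul, inv_mul_cancel₀ hbe,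
        Polynomial.C_1]
    · rw [Polynomial.natDegree_map_of_leadingCoeff_ne_zero _ hbm, hdeg, polyMapDegree, if_pos hf]
    · set x : σ → L := fun i => (eval b (∏ j, d j))⁻¹ * ((P' i).map (eval b)).eval t
      have hx : ∀ i, eval b (∏ j, d j) * x i = ((P' i).map (eval b)).eval t := fun i =>
        mul_inv_cancel_left₀ hbd _
      refine ⟨x, funext fun i => ?_, ?_⟩
      · have h := hspec (Polynomial.C (X i)) b t x (hbss i (Finset.mem_univ i)) hbd ht hx
        simpa [polyFun] using h
      · have h := hspec Polynomial.X b t x hbs hbd ht hx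
        simpa using h

/-- A point of a fibre of a polynomial map is determined by the value of a primitive element. -/
theorem fibre_coordinate {f : σ → MvPolynomial σ L} {θ d : MvPolynomial σ L}
    {P : σ → Polynomial (MvPolynomial σ L)}
    (hP : ∀ i, aeval f d * X i = substHom (aeval f) θ (P i)) {b : σ → L} {B : Type*} [CommRing B]
    [Algebra L B] {ψ : MvPolynomial σ L →ₐ[L] B} (hψ : ∀ i, ψ (f i) = algebraMap L B (b i))
    (i : σ) : eval b d • ψ (X i) = Polynomial.aeval (ψ θ) ((P i).map (eval b)) := by
  rw [← map_substHom hψ, ← hP, map_mul, ← substHom_C (aeval f) θ d, map_substHom hψ,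
    Polynomial.map_C, Polynomial.aeval_C, Algebra.smul_def]

/-- A solution `x` has multiplicity `1` if every homomorphism to an algebra that kills the system
and inverts the polynomials not vanishing at `x` is the evaluation at `x`. -/
theorem multiplicity_eq_one_of_forall {s : σ → MvPolynomial σ L} {x : σ → L}
    (hs : polyFun s x = 0)
    (h : ∀ {B : Type u} [CommRing B] [Algebra L B] (ψ : MvPolynomial σ L →ₐ[L] B),
      (∀ i, ψ (s i) = 0) → (∀ q, eval x q ≠ 0 → IsUnit (ψ q)) →
      ∀ i, ψ (X i) = algebraMap L B (x i)) : multiplicity s x = 1 := by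
  have h1 := h (B := LocalRingAt x ⧸ localIdeal s x)
  have h2 := h1 (toLocalQuotient s x)
  have h3 := h2 (toLocalQuotient_apply_self s x)
  have h4 := h3 fun _ hq => isUnit_toLocalQuotient s hq
  have h5 : ∀ i, toLocalQuotient s x (X i) = algebraMap L _ (x i) := h4
  exact multiplicity_eq_one hs h5

/-- The generic fibre of a dominant polynomial map consists of `polyMapDegree f` simple points. -/
theorem generically_fibre_of_isZariskiDense [IsAlgClosed L] [CharZero L] [Finite σ]
    {f : σ → MvPolynomial σ L} (hf : IsZariskiDense (Set.range (polyFun f))) :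
    Generically fun b : σ → L => {x | polyFun f x = b}.encard = (polyMapDegree f : ℕ∞) ∧
      ∀ x, polyFun f x = b → IsSimpleSolution (fun i => f i - C (b i)) x := by
  obtain ⟨θ, d, D, m, P, hD, hθm, hP, hfib⟩ := exists_fibre_parametrization hf
  refine generically_of_ne_zero hD fun b hb => ?_
  obtain ⟨hbd, hsep, hdeg, hex⟩ := hfib b hb
  have hψ : ∀ x, polyFun f x = b → ∀ i, aeval x (f i) = algebraMap L L (b i) := by
    rintro x rfl i
    rfl
  have hroot : ∀ x, polyFun f x = b → (m.map (eval b)).eval (eval x θ) = 0 := fun x hx => by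
    have h := map_substHom (hψ x hx) θ m
    rw [hθm, map_zero, aeval_eq_eval] at h
    simpa using h.symm
  have hinj : ∀ x y, polyFun f x = b → polyFun f y = b → eval x θ = eval y θ → x = y := by
    intro x y hx hy hxy
    funext i
    have h1 := fibre_coordinate hP (hψ x hx) i
    have h2 := fibre_coordinate hP (hψ y hy) i
    rw [aeval_eq_eval] at h1 h2
    simp only [eval_X, smul_eq_mul] at h1 h2
    exact mul_left_cancel₀ hbd (by rw [h1, h2, hxy])
  refine ⟨?_, fun x hx => ?_⟩
  · classical
    have h1 : Set.InjOn (fun x => eval x θ) {x | polyFun f x = b} := fun x hx y hy => hinj x y hx hy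
    have h2 : (fun x => eval x θ) '' {x | polyFun f x = b} = ((m.map (eval b)).roots.toFinset) := by
      ext t
      simp only [Set.mem_image, Set.mem_ofPred_eq, Finset.mem_coe, Multiset.mem_toFinset,
        Polynomial.mem_roots hsep.ne_zero, Polynomial.IsRoot.def]
      constructor
      · rintro ⟨x, hx, rfl⟩
        exact hroot x hx
      · exact hex t
    rw [← h1.encard_image, h2, Set.encard_coe_eq_coe_finsetCard,
      Multiset.toFinset_card_of_nodup (Polynomial.nodup_roots hsep),
      IsAlgClosed.card_roots_eq_natDegree, hdeg]
  · obtain ⟨q, hq⟩ := Polynomial.dvd_iff_isRoot.2 (hroot x hx)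
    have hqt : q.eval (eval x θ) ≠ 0 := by
      have h := hsep.eval₂_derivative_ne_zero (RingHom.id L) (x := eval x θ) (by
        simpa using hroot x hx)
      simpa [hq] using h
    have hq_aeval : ∀ {B : Type u} [CommRing B] [Algebra L B] (ψ : MvPolynomial σ L →ₐ[L] B),
        ψ (Polynomial.aeval θ q) = Polynomial.aeval (ψ θ) q := fun ψ =>
      (Polynomial.aeval_algHom_apply ψ θ q).symm
    have hq_eval : ∀ y, eval y (Polynomial.aeval θ q) = q.eval (eval y θ) := fun y => by
      simpa [aeval_eq_eval] using hq_aeval (aeval y)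
    have hsol : polyFun (fun i => f i - C (b i)) x = 0 := by
      subst hx
      funext i
      simp [polyFun]
    refine ⟨⟨hsol, {y | eval y (Polynomial.aeval θ q) ≠ 0}, isZariskiOpen_ne_zero _, ?_, ?_⟩, ?_⟩
    · simpa [hq_eval] using hqt
    · intro y hy hys
      have hyb : polyFun f y = b := by
        funext i
        have h := congrFun hys i
        simpa [polyFun, sub_eq_zero] using h
      have h := hroot y hyb
      rw [hq, Polynomial.eval_mul, ← hq_eval] at h
      have h2 := (mul_eq_zero.1 h).resolve_right hy
      exact hinj y x hyb hx (by simpa [sub_eq_zero] using h2)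
    · refine multiplicity_eq_one_of_forall hsol fun {B} _ _ ψ hψ0 hunit i => ?_
      have hψb : ∀ i, ψ (f i) = algebraMap L _ (b i) := fun i => by
        have h := hψ0 i
        rw [map_sub, sub_eq_zero] at h
        exact h.trans (ψ.commutes (b i))
      have h1 : ψ θ = algebraMap L _ (eval x θ) := by
        have h := map_substHom hψb θ m
        rw [hθm, map_zero, hq, map_mul, ← hq_aeval] at h
        have h2 := ((hunit _ (by rwa [hq_eval])).mul_left_eq_zero).1 h.symm
        simpa [sub_eq_zero] using h2
      have h2 := fibre_coordinate hP hψb i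
      have h3 := fibre_coordinate hP (hψ x hx) i
      rw [aeval_eq_eval] at h3
      rw [h1, Polynomial.aeval_algebraMap_apply] at h2
      refine smul_right_injective _ hbd (h2.trans ?_)
      refine (congrArg (algebraMap L _) h3.symm).trans ?_
      rw [eval_X, smul_eq_mul, map_mul]
      exact (Algebra.smul_def _ _).symm

end GenericFibre

/-- The generic fibre of a polynomial map `L^σ → L^σ` consists of `polyMapDegree f` simple points,
whether or not the map is dominant. -/
theorem generically_fibre {L : Type*} [Field L] [IsAlgClosed L] [CharZero L] {σ : Type} [Finite σ]
    (f : σ → MvPolynomial σ L) :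
    Generically fun b : σ → L => {x | polyFun f x = b}.encard = (polyMapDegree f : ℕ∞) ∧
      ∀ x, polyFun f x = b → IsSimpleSolution (fun i => f i - C (b i)) x := by
  by_cases hf : IsZariskiDense (Set.range (polyFun f))
  · exact generically_fibre_of_isZariskiDense hf
  · obtain ⟨p, hp, hpf⟩ := exists_ne_zero_of_not_isZariskiDense hf
    refine generically_of_ne_zero hp fun b hb => ?_
    have h : ∀ x, polyFun f x ≠ b := by
      rintro x rfl
      exact hb (hpf _ ⟨x, rfl⟩)
    refine ⟨?_, fun x hx => absurd hx (h x)⟩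
    rw [polyMapDegree, if_neg hf, Nat.cast_zero, Set.encard_eq_zero]
    exact Set.eq_empty_of_forall_notMem h

theorem entries_injective {L : Type*} [Field L] {n : ℕ} :
    Function.Injective (entries : Matrix (Fin n) (Fin n) L → Fin n × Fin n → L) :=
  fun _ _ h => Matrix.ext fun i j => congrFun h (i, j)

theorem phi_eq_iff {L : Type*} [Field L] {k n : ℕ} (g : NCPoly L k)
    (A : Fin k → Matrix (Fin n) (Fin n) L) (X B : Matrix (Fin n) (Fin n) L) :
    phi g A X = B ↔ polyFun (phiPoly g A) (entries X) = entries B := by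
  rw [polyFun_phiPoly, entries_injective.eq_iff]

end GenericMatrixEq

theorem mainTheorem2 {L : Type*} [Field L] [IsAlgClosed L] [CharZero L] (n k : ℕ) (hn : 2 ≤ n)
    (A : Fin k → Matrix (Fin n) (Fin n) L) (g : GenericMatrixEq.NCPoly L k) (hg : g ≠ 0)
    (hgX : GenericMatrixEq.EveryMonomialContainsX g) :
    GenericMatrixEq.Generically fun b : Fin n × Fin n → L =>
      ∀ B : Matrix (Fin n) (Fin n) L, GenericMatrixEq.entries B = b →
        {X : Matrix (Fin n) (Fin n) L | GenericMatrixEq.phi g A X = B}.encard =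
            (GenericMatrixEq.phiDegree g A : ℕ∞) ∧
          ∀ X : Matrix (Fin n) (Fin n) L, GenericMatrixEq.phi g A X = B →
            GenericMatrixEq.IsSimpleSolution (GenericMatrixEq.eqSystem g A B)
              (GenericMatrixEq.entries X) := by
  obtain ⟨U, hUo, hUd, hU⟩ := GenericMatrixEq.generically_fibre (GenericMatrixEq.phiPoly g A)
  refine ⟨U, hUo, hUd, fun b hb B hB => ?_⟩
  obtain ⟨hcard, hsimple⟩ := hU b hb
  subst hB
  refine ⟨?_, fun X hX => hsimple _ ((GenericMatrixEq.phi_eq_iff g A X B).1 hX)⟩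
  rw [GenericMatrixEq.phiDegree, ← hcard, ← GenericMatrixEq.entries_injective.encard_image]
  congr 1
  ext x
  constructor
  · rintro ⟨X, hX, rfl⟩
    exact (GenericMatrixEq.phi_eq_iff g A X B).1 hX
  · intro hx
    exact ⟨Matrix.of fun i j => x (i, j), (GenericMatrixEq.phi_eq_iff g A _ B).2 hx, rfl⟩
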